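/- For $u\in L^2(\mathbb R^3;\mathbb C)$ let $\hat u$ be the Fourier transform with the normalization $\hat u(\xi)=\int_{\mathbb R^3}e^{-2\pi i x\cdot\xi}u(x)\,dx$, and put $$\|u\|_{H^{1/2}}^2=\int_{\mathbb R^3}(1+|\xi|^2)^{1/2}|\hat u(\xi)|^2\,d\xi,\qquad \|u\|_{\dot H^{1/2}}^2=\int_{\mathbb R^3}|\xi|\,|\hat u(\xi)|^2\,d\xi,\qquad D(u)=\iint_{\mathbb R^3\times\mathbb R^3}\frac{|u(x)|^2|u(y)|^2}{|x-y|}\,dx\,dy .$$ Let $H^{1/2}(\mathbb R^3)=\{u\in L^2(\mathbb R^3;\mathbb C):\|u\|_{H^{1/2}}<\infty\}$. For $\alpha,\beta,\rho>0$ define $$I_{8/3}^{\alpha,\beta}(\rho)=\inf\Big\{\tfrac12\|u\|_{H^{1/2}}^2+\alpha D(u)-\beta\int_{\mathbb R^3}|u|^{8/3}\,dx \;:\; u\in H^{1/2}(\mathbb R^3),\ \int_{\mathbb R^3}|u|^2\,dx=\rho\Big\}\in[-\infty,\infty).$$ Let $S$ be the infimum of all $C\in(0,\infty]$ such that $$\|\varphi\|_{L^{8/3}(\mathbb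 R^3)}\le C\,\|\varphi\|_{\dot H^{1/2}}^{1/2}\,D(\varphi)^{1/8}\qquad\text{for all }\varphi\in C_0^\infty(\mathbb R^3;\mathbb C).$$ **Theorem.** Let $\alpha,\beta>0$ be fixed. Then the following are equivalent: 1. there exists $\rho>0$ such that $I_{8/3}^{\alpha,\beta}(\rho)=-\infty$; 2. $\left(\dfrac{27\alpha}{\beta^3}\right)^{1/8}<\sqrt2\,S$. -/

import Mathlib

open MeasureTheory FourierTransform
open scoped ENNReal ContDiff

noncomputable section

namespace SemiRelativistic

/-- Euclidean three-space `ℝ³`. -/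
abbrev R3 : Type := EuclideanSpace ℝ (Fin 3)

/-- The complex space `L²(ℝ³)`. -/
abbrev L2 : Type := Lp ℂ 2 (volume : Measure R3)

/-- The Coulomb energy `∬ |f(x)|² |f(y)|² / |x - y| dx dy`. -/
def coulomb (f : R3 → ℂ) : ℝ≥0∞ :=
  ∫⁻ x, ∫⁻ y, ‖f x‖ₑ ^ 2 * ‖f y‖ₑ ^ 2 / ‖x - y‖ₑ

/-- The squared norm `‖u‖²_{H^s} = ∫ (1 + |ξ|²)^s |û(ξ)|² dξ` of `u ∈ L²(ℝ³)`, possibly `∞`, where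
`û` is the Fourier transform on `L²`, with kernel `e^{-2πi x·ξ}`. -/
def sobolevNormSq (s : ℝ) (u : L2) : ℝ≥0∞ :=
  ∫⁻ ξ, ENNReal.ofReal ((1 + ‖ξ‖ ^ 2) ^ s) * ‖(𝓕 u : L2) ξ‖ₑ ^ 2

/-- The homogeneous norm `‖φ‖_{Ḣ^s} = (∫ |ξ|^{2s} |φ̂(ξ)|² dξ)^{1/2}` of an integrable function,
where `φ̂(ξ) = ∫ e^{-2πi x·ξ} φ(x) dx`. -/
def homSobolevNorm (s : ℝ) (φ : R3 → ℂ) : ℝ≥0∞ :=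
  (∫⁻ ξ, ENNReal.ofReal (‖ξ‖ ^ (2 * s)) * ‖𝓕 φ ξ‖ₑ ^ 2) ^ (1 / 2 : ℝ)

/-- The sphere `S(ρ) = {u ∈ H^{1/2}(ℝ³) : ∫ |u|² = ρ}`. -/
def sphere (ρ : ℝ) : Set L2 :=
  {u | sobolevNormSq (1 / 2) u < ⊤ ∧ ∫ x, ‖u x‖ ^ 2 = ρ}

/-- The energy `½ ‖u‖²_{H^{1/2}} + α ∬ |u(x)|²|u(y)|²/|x-y| dx dy - β ∫ |u|^p`.
For `u ∈ H^{1/2}(ℝ³)` and `2 ≤ p ≤ 3` the three terms are finite, so this is a real number. -/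
def energy (p α β : ℝ) (u : L2) : EReal :=
  ((1 / 2 : ℝ) : EReal) * (sobolevNormSq (1 / 2) u : EReal)
    + (α : EReal) * (coulomb u : EReal)
    - (β : EReal) * ((∫⁻ x, ‖u x‖ₑ ^ p : ℝ≥0∞) : EReal)

/-- The infimum `I_p^{α,β}(ρ)` of the energy over `S(ρ)`, an extended real number. -/
def minEnergy (p α β ρ : ℝ) : EReal :=
  ⨅ u ∈ sphere ρ, energy p α β u

/-- `‖φ‖_{8/3} ≤ C ‖φ‖_{Ḣ^{1/2}}^{1/2} (∬ |φ(x)|²|φ(y)|²/|x-y| dx dy)^{1/8}` for every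
`φ ∈ C_0^∞(ℝ³)`. -/
def InterpolationInequality (C : ℝ≥0∞) : Prop :=
  ∀ φ : R3 → ℂ, ContDiff ℝ (∞ : WithTop ℕ∞) φ → HasCompactSupport φ →
    eLpNorm φ (8 / 3) volume
      ≤ C * homSobolevNorm (1 / 2) φ ^ (1 / 2 : ℝ) * coulomb φ ^ (1 / 8 : ℝ)

/-- The best constant `S = inf {C ∈ (0, ∞] : C satisfies the interpolation inequality}`. -/
def bestConstant : ℝ≥0∞ :=
  sInf {C : ℝ≥0∞ | 0 < C ∧ InterpolationInequality C}

end SemiRelativistic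

end

/-!
Write `T = ‖u‖²_{H^{1/2}}` and `P = ∫ |u|^{8/3}`. The arithmetic–geometric mean inequality for
`T/4`, `T/4`, `α D` gives `27 α T² D / 16 ≤ (T/2 + α D)³`, while the interpolation inequality with
best constant reads `P³ ≤ S⁸ T² D`. Hence the energy is nonnegative as soon as
`16 β³ S⁸ ≤ 27 α`.

Otherwise some `f ∈ C_0^∞` violates the inequality with the critical constant in place of `S`. The
functions `(s l)^{3/2} f(l x)` all have mass `s³ ‖f‖₂²`, their homogeneous energies are proportional
to `l`, and for the amplitude `s` giving equality in the mean inequality the factor is negative;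
letting `l → ∞` sends the energy to `-∞`.

The interpolation inequality is assumed only on `C_0^∞`. Bounding the Coulomb energy by `‖f‖₂` and
`‖f‖_{8/3}` turns it into a Sobolev inequality, by absorption. This makes the Coulomb energy
continuous for the `H^{1/2}` norm, so that the interpolation inequality passes to all of `H^{1/2}`
by density.
-/

noncomputable section

namespace SemiRelativistic

open scoped SchwartzMap
open Filter Topology

section SchwartzDensity

variable {E F : Type*} [NormedAddCommGroup E] [NormedSpace ℝ E] [NormedAddCommGroup F]
  [NormedSpace ℝ F]

lemma norm_iteratedFDeriv_comp_smul_le (χ : 𝓢(E, ℝ)) {ε : ℝ} (hε₀ : 0 ≤ ε) (hε₁ : ε ≤ 1) (i : ℕ)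
    (x : E) :
    ‖iteratedFDeriv ℝ i (fun y ↦ χ (ε • y)) x‖ ≤ SchwartzMap.seminorm ℝ 0 i χ := by
  rw [iteratedFDeriv_comp_const_smul ε (χ.smooth i), norm_smul, norm_pow, Real.norm_of_nonneg hε₀]
  calc ε ^ i * ‖iteratedFDeriv ℝ i χ (ε • x)‖
      ≤ 1 * ‖iteratedFDeriv ℝ i χ (ε • x)‖ := by gcongr; exact pow_le_one₀ hε₀ hε₁
    _ ≤ SchwartzMap.seminorm ℝ 0 i χ := by
        rw [one_mul]; exact SchwartzMap.norm_iteratedFDeriv_le_seminorm ℝ χ i _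

lemma pow_mul_norm_iteratedFDeriv_smul_le (χ : 𝓢(E, ℝ)) (f : 𝓢(E, F)) {ε : ℝ} (hε₀ : 0 ≤ ε)
    (hε₁ : ε ≤ 1) (k l : ℕ) (x : E) :
    ‖x‖ ^ k * ‖iteratedFDeriv ℝ l (fun y ↦ χ (ε • y) • f y) x‖ ≤
      ∑ i ∈ Finset.range (l + 1), (l.choose i : ℝ) * SchwartzMap.seminorm ℝ 0 i χ *
        SchwartzMap.seminorm ℝ k (l - i) f := by
  have leibniz := norm_iteratedFDeriv_smul_le (f := fun y ↦ χ (ε • y)) (N := (l : ℕ∞))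
    ((χ.smooth l).comp (contDiff_const_smul ε)) (f.smooth l) x le_rfl
  calc ‖x‖ ^ k * ‖iteratedFDeriv ℝ l (fun y ↦ χ (ε • y) • f y) x‖
      ≤ ∑ i ∈ Finset.range (l + 1), (l.choose i : ℝ) *
          ‖iteratedFDeriv ℝ i (fun y ↦ χ (ε • y)) x‖ *
            (‖x‖ ^ k * ‖iteratedFDeriv ℝ (l - i) f x‖) := by
        grw [leibniz, Finset.mul_sum]
        exact (Finset.sum_congr rfl fun i _ ↦ by ring).le
    _ ≤ _ := by
        gcongr with i
        · exact norm_iteratedFDeriv_comp_smul_le χ hε₀ hε₁ i x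
        · exact SchwartzMap.le_seminorm ℝ k (l - i) f x

lemma hasTemperateGrowth_comp_smul (χ : 𝓢(E, ℝ)) (ε : ℝ) :
    (fun y ↦ χ (ε • y)).HasTemperateGrowth :=
  χ.hasTemperateGrowth.comp (ε • ContinuousLinearMap.id ℝ E).hasTemperateGrowth

/-- The difference vanishes on the ball of radius `ε⁻¹`, so outside it a power of `ε * ‖x‖` can be
spent. -/
lemma seminorm_sub_cutoff_le (χ : 𝓢(E, ℝ)) (hχ : ∀ x, ‖x‖ < 1 → χ x = 1) (f : 𝓢(E, F)) (k l : ℕ) :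
    ∃ B, ∀ ε, 0 ≤ ε → ε ≤ 1 →
      SchwartzMap.seminorm ℝ k l (f - SchwartzMap.smulLeftCLM F (fun y ↦ χ (ε • y)) f) ≤ ε * B := by
  refine ⟨SchwartzMap.seminorm ℝ (k + 1) l f + ∑ i ∈ Finset.range (l + 1), (l.choose i : ℝ) *
    SchwartzMap.seminorm ℝ 0 i χ * SchwartzMap.seminorm ℝ (k + 1) (l - i) f, fun ε hε₀ hε₁ ↦ ?_⟩
  refine SchwartzMap.seminorm_le_bound ℝ k l _ (by positivity) fun x ↦ ?_
  set g := SchwartzMap.smulLeftCLM F (fun y ↦ χ (ε • y)) f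
  have hg : (g : E → F) = fun y ↦ χ (ε • y) • f y :=
    SchwartzMap.smulLeftCLM_apply (hasTemperateGrowth_comp_smul χ ε) f
  rcases lt_or_ge (ε * ‖x‖) 1 with hx | hx
  · have hzero : ⇑(f - g) =ᶠ[𝓝 x] fun _ ↦ 0 := by
      have hnear : ∀ᶠ y in 𝓝 x, ε * ‖y‖ < 1 :=
        (continuous_const.mul continuous_norm).continuousAt.eventually_lt_const hx
      filter_upwards [hnear] with y hy
      have : χ (ε • y) = 1 := hχ _ (by rwa [norm_smul, Real.norm_of_nonneg hε₀])
      simp [hg, this]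
    rw [hzero.iteratedFDeriv ℝ l |>.eq_of_nhds]
    simp only [iteratedFDeriv_fun_zero, Pi.zero_apply, norm_zero, mul_zero]
    positivity
  · have hsub : iteratedFDeriv ℝ l ⇑(f - g) x = iteratedFDeriv ℝ l f x - iteratedFDeriv ℝ l g x :=
      iteratedFDeriv_sub_apply (f.smooth l).contDiffAt (g.smooth l).contDiffAt
    calc ‖x‖ ^ k * ‖iteratedFDeriv ℝ l ⇑(f - g) x‖
        ≤ (ε * ‖x‖) * (‖x‖ ^ k * ‖iteratedFDeriv ℝ l ⇑(f - g) x‖) :=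
          le_mul_of_one_le_left (by positivity) hx
      _ ≤ (ε * ‖x‖) * (‖x‖ ^ k * (‖iteratedFDeriv ℝ l f x‖ + ‖iteratedFDeriv ℝ l g x‖)) := by
          rw [hsub]; gcongr; exact norm_sub_le _ _
      _ = ε * (‖x‖ ^ (k + 1) * ‖iteratedFDeriv ℝ l f x‖ +
            ‖x‖ ^ (k + 1) * ‖iteratedFDeriv ℝ l g x‖) := by ring
      _ ≤ _ := by
          gcongr
          · exact SchwartzMap.le_seminorm ℝ (k + 1) l f x
          · rw [hg]; exact pow_mul_norm_iteratedFDeriv_smul_le χ f hε₀ hε₁ (k + 1) l x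

lemma tendsto_cutoff (χ : 𝓢(E, ℝ)) (hχ : ∀ x, ‖x‖ < 1 → χ x = 1) (f : 𝓢(E, F)) :
    Tendsto (fun ε : ℝ ↦ SchwartzMap.smulLeftCLM F (fun y ↦ χ (ε • y)) f) (𝓝[>] 0) (𝓝 f) := by
  rw [(schwartz_withSeminorms ℝ E F).tendsto_nhds _ f]
  rintro ⟨k, l⟩ δ hδ
  obtain ⟨B, hB⟩ := seminorm_sub_cutoff_le χ hχ f k l
  have hlim : Tendsto (fun ε : ℝ ↦ ε * B) (𝓝[>] 0) (𝓝 0) := by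
    have : Tendsto (fun ε : ℝ ↦ ε * B) (𝓝 0) (𝓝 (0 * B)) := tendsto_id.mul_const B
    exact (zero_mul B ▸ this).mono_left nhdsWithin_le_nhds
  filter_upwards [hlim.eventually_lt_const hδ, Ioc_mem_nhdsGT zero_lt_one] with ε hεB hε
  rw [map_sub_rev]
  exact (hB ε hε.1.le hε.2).trans_lt hεB

lemma dense_hasCompactSupport [FiniteDimensional ℝ E] :
    Dense {f : 𝓢(E, F) | HasCompactSupport f} := by
  intro f
  let χ : ContDiffBump (0 : E) := ⟨1, 2, one_pos, one_lt_two⟩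
  let χ' : 𝓢(E, ℝ) := χ.hasCompactSupport.toSchwartzMap χ.contDiff
  have hχ (x : E) (hx : ‖x‖ < 1) : χ' x = 1 :=
    χ.one_of_mem_closedBall (by simpa [χ] using hx.le)
  refine mem_closure_of_tendsto (tendsto_cutoff χ' hχ f) ?_
  filter_upwards [self_mem_nhdsWithin] with ε (hε : 0 < ε)
  rw [SchwartzMap.smulLeftCLM_apply (hasTemperateGrowth_comp_smul χ' ε)]
  exact (χ.hasCompactSupport.comp_smul hε.ne').smul_right

end SchwartzDensity

section Young

variable {G : Type*} [AddGroup G] [MeasurableSpace G] [MeasurableAdd₂ G] [MeasurableNeg G]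
  {μ : Measure G} [SFinite μ] {f g k : G → ℝ≥0∞}

lemma lintegral_prod_fst_mul_sub [μ.IsAddLeftInvariant] [μ.IsNegInvariant] (hf : Measurable f)
    (hk : Measurable k) :
    ∫⁻ z : G × G, f z.1 * k (z.1 - z.2) ∂μ.prod μ = (∫⁻ x, f x ∂μ) * ∫⁻ x, k x ∂μ := by
  rw [lintegral_prod _ (by fun_prop), ← lintegral_mul_const _ hf]
  refine lintegral_congr fun x ↦ ?_
  dsimp only
  rw [lintegral_const_mul _ (by fun_prop), lintegral_sub_left_eq_self k x]

lemma lintegral_prod_snd_mul_sub [μ.IsAddRightInvariant] (hg : Measurable g)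
    (hk : Measurable k) :
    ∫⁻ z : G × G, g z.2 * k (z.1 - z.2) ∂μ.prod μ = (∫⁻ x, g x ∂μ) * ∫⁻ x, k x ∂μ := by
  rw [lintegral_prod_symm _ (by fun_prop), ← lintegral_mul_const _ hg]
  refine lintegral_congr fun y ↦ ?_
  dsimp only
  rw [lintegral_const_mul _ (by fun_prop), lintegral_sub_right_eq_self k y]

/-- Young's convolution inequality, stated for the powers of the three functions which are
integrable: in the usual notation `a + b = 1 / p`, `a + c = 1 / q` and `b + c = 1 / r`. -/
lemma lintegral_rpow_mul_rpow_mul_rpow_sub_le [μ.IsAddLeftInvariant] [μ.IsAddRightInvariant]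
    [μ.IsNegInvariant] (hf : Measurable f) (hg : Measurable g) (hk : Measurable k)
    {a b c : ℝ} (ha : 0 ≤ a) (hb : 0 ≤ b) (hc : 0 ≤ c) (habc : a + b + c = 1) :
    ∫⁻ z : G × G, f z.1 ^ (a + b) * g z.2 ^ (a + c) * k (z.1 - z.2) ^ (b + c) ∂μ.prod μ ≤
      (∫⁻ x, f x ∂μ) ^ (a + b) * (∫⁻ x, g x ∂μ) ^ (a + c) * (∫⁻ x, k x ∂μ) ^ (b + c) := by
  have regroup (x y z : ℝ≥0∞) :
      (x * y) ^ a * (x * z) ^ b * (y * z) ^ c = x ^ (a + b) * y ^ (a + c) * z ^ (b + c) := by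
    simp only [ENNReal.mul_rpow_of_nonneg _ _ ha, ENNReal.mul_rpow_of_nonneg _ _ hb,
      ENNReal.mul_rpow_of_nonneg _ _ hc, ENNReal.rpow_add_of_nonneg _ _ ha hb,
      ENNReal.rpow_add_of_nonneg _ _ ha hc, ENNReal.rpow_add_of_nonneg _ _ hb hc]
    ring
  have hölder := ENNReal.lintegral_prod_norm_pow_le (μ := μ.prod μ) Finset.univ
    (f := ![fun z ↦ f z.1 * g z.2, fun z ↦ f z.1 * k (z.1 - z.2), fun z ↦ g z.2 * k (z.1 - z.2)])
    (p := ![a, b, c]) (fun i _ ↦ by fin_cases i <;> dsimp <;> fun_prop)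
    (by simpa [Fin.sum_univ_three] using habc)
    (by simp [Fin.forall_fin_succ, ha, hb, hc])
  simp only [Fin.prod_univ_three, Matrix.cons_val, regroup, lintegral_prod_fst_mul_sub hf hk,
    lintegral_prod_snd_mul_sub hg hk, lintegral_prod_mul hf.aemeasurable hg.aemeasurable] at hölder
  exact hölder

end Young

section Coulomb

/-- The interaction energy `∬ |f(x)|² |g(y)|² / |x - y| dx dy` of two charge densities. -/
def coulombInteraction (f g : R3 → ℂ) : ℝ≥0∞ :=
  ∫⁻ x, ∫⁻ y, ‖f x‖ₑ ^ 2 * ‖g y‖ₑ ^ 2 / ‖x - y‖ₑ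

/-- The singular part `1_{|z| < 1} / |z|` of the Coulomb kernel. -/
def localKernel : R3 → ℝ≥0∞ := (Metric.ball 0 1).indicator fun z ↦ ‖z‖ₑ⁻¹

@[fun_prop]
lemma measurable_localKernel : Measurable localKernel :=
  Measurable.indicator (by fun_prop) Metric.isOpen_ball.measurableSet

lemma inv_enorm_le (z : R3) : ‖z‖ₑ⁻¹ ≤ 1 + localKernel z := by
  by_cases hz : z ∈ Metric.ball (0 : R3) 1
  · rw [localKernel, Set.indicator_of_mem hz]
    exact le_add_self
  · refine le_add_right ?_
    rw [ENNReal.inv_le_one, ← ofReal_norm, ENNReal.one_le_ofReal]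
    simpa using hz

lemma lintegral_localKernel_sq_ne_top : ∫⁻ z, localKernel z ^ 2 ≠ ⊤ := by
  have hint : IntegrableOn (fun z : R3 ↦ (‖z‖ ^ 2)⁻¹) (Metric.ball 0 1) := by
    rw [integrableOn_fun_norm_addHaar volume (f := fun r : ℝ ↦ (r ^ 2)⁻¹),
      finrank_euclideanSpace_fin]
    refine (integrableOn_const (C := (1 : ℝ)) (by simp)).congr_fun (fun r hr ↦ ?_) measurableSet_Ioo
    simp [hr.1.ne']
  have hle : ∫⁻ z, localKernel z ^ 2 ≤ ∫⁻ z in Metric.ball (0 : R3) 1, ‖(‖z‖ ^ 2)⁻¹‖ₑ := by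
    rw [← lintegral_indicator Metric.isOpen_ball.measurableSet]
    refine lintegral_mono_ae ?_
    filter_upwards [Measure.ae_ne volume (0 : R3)] with z hz
    by_cases hball : z ∈ Metric.ball (0 : R3) 1
    · rw [localKernel, Set.indicator_of_mem hball, Set.indicator_of_mem hball,
        enorm_inv (by simpa using hz), enorm_pow, enorm_norm, ENNReal.inv_pow]
    · simp [localKernel, hball]
  exact (hle.trans_lt hint.2).ne

/-- The `L²` norm of `localKernel`, the constant in the estimate of the Coulomb energy by
`‖f‖₂` and `‖f‖_{8/3}`. -/
def coulombConstant : ℝ≥0∞ := (∫⁻ z, localKernel z ^ 2) ^ (1 / 2 : ℝ)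

lemma coulombConstant_ne_top : coulombConstant ≠ ⊤ :=
  ENNReal.rpow_ne_top_of_nonneg (by norm_num) lintegral_localKernel_sq_ne_top

variable {f g : R3 → ℂ}

lemma coulombInteraction_eq_lintegral_prod (hf : Measurable f) (hg : Measurable g) :
    coulombInteraction f g =
      ∫⁻ z : R3 × R3, ‖f z.1‖ₑ ^ 2 * ‖g z.2‖ₑ ^ 2 * ‖z.1 - z.2‖ₑ⁻¹ := by
  rw [Measure.volume_eq_prod, lintegral_prod _ (by fun_prop)]
  rfl

lemma coulombInteraction_comm (hf : Measurable f) (hg : Measurable g) :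
    coulombInteraction f g = coulombInteraction g f := by
  rw [coulombInteraction, lintegral_lintegral_swap (by fun_prop)]
  simp only [coulombInteraction, enorm_sub_rev, mul_comm (‖g _‖ₑ ^ 2)]

lemma eLpNorm_eight_thirds_sq {α F : Type*} [MeasurableSpace α] [NormedAddCommGroup F]
    (μ : Measure α) (f : α → F) :
    eLpNorm f (8 / 3) μ ^ 2 = (∫⁻ x, ‖f x‖ₑ ^ (8 / 3 : ℝ) ∂μ) ^ (3 / 4 : ℝ) := by
  have h : ((8 : ℝ≥0∞) / 3).toReal = 8 / 3 := by simp
  rw [eLpNorm_eq_lintegral_rpow_enorm_toReal (by simp) (by simp [ENNReal.div_eq_top]), h,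
    ← ENNReal.rpow_natCast, ← ENNReal.rpow_mul]
  norm_num

lemma eLpNorm_two_sq {α F : Type*} [MeasurableSpace α] [NormedAddCommGroup F] (μ : Measure α)
    (f : α → F) :
    eLpNorm f 2 μ ^ 2 = ∫⁻ x, ‖f x‖ₑ ^ 2 ∂μ := by
  simpa using eLpNorm_nnreal_pow_eq_lintegral (f := f) (μ := μ) (p := 2) two_ne_zero

lemma lintegral_mul_localKernel_le (hf : Measurable f) (hg : Measurable g) :
    ∫⁻ z : R3 × R3, ‖f z.1‖ₑ ^ 2 * ‖g z.2‖ₑ ^ 2 * localKernel (z.1 - z.2) ≤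
      coulombConstant * eLpNorm f (8 / 3) volume ^ 2 * eLpNorm g (8 / 3) volume ^ 2 := by
  have young := lintegral_rpow_mul_rpow_mul_rpow_sub_le (μ := (volume : Measure R3))
    (f := fun x ↦ ‖f x‖ₑ ^ (8 / 3 : ℝ)) (g := fun x ↦ ‖g x‖ₑ ^ (8 / 3 : ℝ))
    (k := fun z ↦ localKernel z ^ (2 : ℝ)) (a := 1 / 2) (b := 1 / 4) (c := 1 / 4)
    (by fun_prop) (by fun_prop) (by fun_prop) (by norm_num) (by norm_num) (by norm_num)
    (by norm_num)
  simp only [← ENNReal.rpow_mul] at young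
  norm_num only [ENNReal.rpow_one, ENNReal.rpow_ofNat] at young
  rw [eLpNorm_eight_thirds_sq, eLpNorm_eight_thirds_sq, coulombConstant, Measure.volume_eq_prod]
  refine young.trans_eq ?_
  ring

lemma coulombInteraction_le (hf : Measurable f) (hg : Measurable g) :
    coulombInteraction f g ≤ eLpNorm f 2 volume ^ 2 * eLpNorm g 2 volume ^ 2 +
      coulombConstant * eLpNorm f (8 / 3) volume ^ 2 * eLpNorm g (8 / 3) volume ^ 2 := by
  calc coulombInteraction f g
      ≤ ∫⁻ z : R3 × R3, (‖f z.1‖ₑ ^ 2 * ‖g z.2‖ₑ ^ 2 +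
          ‖f z.1‖ₑ ^ 2 * ‖g z.2‖ₑ ^ 2 * localKernel (z.1 - z.2)) := by
        rw [coulombInteraction_eq_lintegral_prod hf hg]
        refine lintegral_mono fun z ↦ ?_
        grw [inv_enorm_le, mul_add, mul_one]
    _ = eLpNorm f 2 volume ^ 2 * eLpNorm g 2 volume ^ 2 +
          ∫⁻ z : R3 × R3, ‖f z.1‖ₑ ^ 2 * ‖g z.2‖ₑ ^ 2 * localKernel (z.1 - z.2) := by
        rw [lintegral_add_left (by fun_prop), Measure.volume_eq_prod, eLpNorm_two_sq,
          eLpNorm_two_sq, ← lintegral_prod_mul (by fun_prop) (by fun_prop)]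
    _ ≤ _ := by grw [lintegral_mul_localKernel_le hf hg]

lemma sqrt_coulombInteraction_le_add {h : R3 → ℂ} (hf : Measurable f) (hg : Measurable g)
    (hh : Measurable h) :
    coulombInteraction f h ^ (1 / 2 : ℝ) ≤
      coulombInteraction g h ^ (1 / 2 : ℝ) + coulombInteraction (f - g) h ^ (1 / 2 : ℝ) := by
  let root (f : R3 → ℂ) (z : R3 × R3) : ℝ≥0∞ := ‖f z.1‖ₑ * ‖h z.2‖ₑ * ‖z.1 - z.2‖ₑ⁻¹ ^ (1 / 2 : ℝ)
  have hroot {f : R3 → ℂ} (hf : Measurable f) : Measurable (root f) := by fun_prop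
  have heq {f : R3 → ℂ} (hf : Measurable f) :
      coulombInteraction f h = ∫⁻ z, root f z ^ (2 : ℝ) := by
    rw [coulombInteraction_eq_lintegral_prod hf hh]
    refine lintegral_congr fun z ↦ ?_
    rw [ENNReal.mul_rpow_of_nonneg _ _ zero_le_two, ← ENNReal.rpow_mul]
    simp [mul_pow]
  rw [heq hf, heq hg, heq (hf.sub hg)]
  refine le_trans ?_ (ENNReal.lintegral_Lp_add_le (hroot hg).aemeasurable
    (hroot (hf.sub hg)).aemeasurable one_le_two)
  gcongr with z
  have htriangle : ‖f z.1‖ₑ ≤ ‖g z.1‖ₑ + ‖(f - g) z.1‖ₑ := by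
    simpa using enorm_add_le (g z.1) (f z.1 - g z.1)
  simp only [root, Pi.add_apply]
  grw [htriangle, add_mul, add_mul]

lemma sqrt_coulomb_le (hf : Measurable f) (hg : Measurable g) :
    coulomb f ^ (1 / 2 : ℝ) ≤ coulomb g ^ (1 / 2 : ℝ) +
      coulombInteraction (f - g) g ^ (1 / 2 : ℝ) + coulombInteraction (f - g) f ^ (1 / 2 : ℝ) := by
  calc coulomb f ^ (1 / 2 : ℝ)
      ≤ coulombInteraction f g ^ (1 / 2 : ℝ) + coulombInteraction (f - g) f ^ (1 / 2 : ℝ) := by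
        rw [coulombInteraction_comm hf hg]
        exact sqrt_coulombInteraction_le_add hf hg hf
    _ ≤ _ := by grw [sqrt_coulombInteraction_le_add hf hg hg]; rfl

end Coulomb

section Sobolev

/-- The function `(1 + |ξ|²)^{s/2} û(ξ)`, whose `L²` norm is `‖u‖_{H^s}`. -/
def weightedFourier (s : ℝ) (u : L2) (ξ : R3) : ℂ := (1 + ‖ξ‖ ^ 2) ^ (s / 2) • (𝓕 u : L2) ξ

/-- The norm `‖u‖_{H^s}`, possibly `∞`. -/
def sobolevNorm (s : ℝ) (u : L2) : ℝ≥0∞ := eLpNorm (weightedFourier s u) 2 volume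

/-- `weightedFourier` as an operator on Schwartz functions, where it is surjective; this yields the
density of `C_0^∞` in `H^s`. -/
def schwartzWeightedFourier (s : ℝ) : 𝓢(R3, ℂ) →L[ℝ] 𝓢(R3, ℂ) :=
  (SchwartzMap.smulLeftCLM ℂ fun ξ : R3 ↦ (1 + ‖ξ‖ ^ 2) ^ (s / 2)).comp (fourierCLM ℝ 𝓢(R3, ℂ))

lemma sobolevNorm_sq (s : ℝ) (u : L2) : sobolevNorm s u ^ 2 = sobolevNormSq s u := by
  rw [sobolevNorm, eLpNorm_two_sq, sobolevNormSq]
  refine lintegral_congr fun ξ ↦ ?_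
  have hbase : 0 ≤ 1 + ‖ξ‖ ^ 2 := by positivity
  rw [weightedFourier, enorm_smul, mul_pow, Real.enorm_of_nonneg (by positivity),
    ← ENNReal.ofReal_pow (by positivity), ← Real.rpow_natCast, ← Real.rpow_mul hbase]
  norm_num

lemma sobolevNorm_lt_top {s : ℝ} {u : L2} : sobolevNorm s u < ⊤ ↔ sobolevNormSq s u < ⊤ := by
  rw [← sobolevNorm_sq, ENNReal.pow_lt_top_iff]
  simp

lemma aestronglyMeasurable_weightedFourier (s : ℝ) (u : L2) :
    AEStronglyMeasurable (weightedFourier s u) volume := by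
  have hweight : Measurable fun ξ : R3 ↦ (1 + ‖ξ‖ ^ 2) ^ (s / 2) := by fun_prop
  exact hweight.aestronglyMeasurable.smul (Lp.aestronglyMeasurable _)

lemma weightedFourier_sub (s : ℝ) (u v : L2) :
    weightedFourier s (u - v) =ᵐ[volume] weightedFourier s u - weightedFourier s v := by
  have hfourier : (𝓕 (u - v) : L2) = 𝓕 u - 𝓕 v := (Lp.fourierTransformₗᵢ R3 ℂ).map_sub u v
  filter_upwards [Lp.coeFn_sub (𝓕 u : L2) (𝓕 v)] with ξ hξ
  rw [weightedFourier, hfourier, hξ, Pi.sub_apply, smul_sub]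
  rfl

lemma sobolevNorm_le_add (s : ℝ) (u v : L2) :
    sobolevNorm s v ≤ sobolevNorm s u + sobolevNorm s (v - u) := by
  have hsplit : weightedFourier s v =ᵐ[volume] weightedFourier s u + weightedFourier s (v - u) := by
    filter_upwards [weightedFourier_sub s v u] with ξ hξ
    rw [Pi.add_apply, hξ, Pi.sub_apply, add_sub_cancel]
  rw [sobolevNorm, eLpNorm_congr_ae hsplit]
  exact eLpNorm_add_le (aestronglyMeasurable_weightedFourier s u)
    (aestronglyMeasurable_weightedFourier s _) one_le_two

lemma eLpNorm_fourier (u : L2) : eLpNorm (𝓕 u : L2) 2 volume = eLpNorm u 2 volume := by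
  rw [← Lp.enorm_def, ← Lp.enorm_def, ← ofReal_norm, ← ofReal_norm, Lp.norm_fourier_eq]

lemma eLpNorm_le_sobolevNorm {s : ℝ} (hs : 0 ≤ s) (u : L2) :
    eLpNorm u 2 volume ≤ sobolevNorm s u := by
  rw [← eLpNorm_fourier]
  refine eLpNorm_mono fun ξ ↦ ?_
  rw [weightedFourier, norm_smul, Real.norm_of_nonneg (by positivity)]
  refine le_mul_of_one_le_left (norm_nonneg _) (Real.one_le_rpow ?_ (by positivity))
  linarith [sq_nonneg ‖ξ‖]

lemma hasTemperateGrowth_weight (s : ℝ) :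
    (fun ξ : R3 ↦ (1 + ‖ξ‖ ^ 2) ^ (s / 2)).HasTemperateGrowth :=
  Function.hasTemperateGrowth_one_add_norm_sq_rpow R3 (s / 2)

lemma weightedFourier_toLp (s : ℝ) (f : 𝓢(R3, ℂ)) :
    weightedFourier s (f.toLp 2) =ᵐ[volume] schwartzWeightedFourier s f := by
  filter_upwards [(𝓕 f).coeFn_toLp 2 volume] with ξ hξ
  rw [weightedFourier, SchwartzMap.toLp_fourier_eq, hξ, schwartzWeightedFourier,
    ContinuousLinearMap.comp_apply, fourierCLM_apply,
    SchwartzMap.smulLeftCLM_apply_apply (hasTemperateGrowth_weight s)]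

lemma sobolevNorm_toLp (s : ℝ) (f : 𝓢(R3, ℂ)) :
    sobolevNorm s (f.toLp 2) = eLpNorm (schwartzWeightedFourier s f) 2 volume :=
  eLpNorm_congr_ae (weightedFourier_toLp s f)

lemma surjective_schwartzWeightedFourier (s : ℝ) :
    Function.Surjective (schwartzWeightedFourier s) := by
  intro g
  refine ⟨𝓕⁻ (SchwartzMap.smulLeftCLM ℂ (fun ξ : R3 ↦ (1 + ‖ξ‖ ^ 2) ^ (-s / 2)) g), ?_⟩
  ext ξ
  have hbase : 0 < 1 + ‖ξ‖ ^ 2 := by positivity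
  rw [schwartzWeightedFourier, ContinuousLinearMap.comp_apply, fourierCLM_apply,
    FourierTransform.fourier_fourierInv_eq,
    SchwartzMap.smulLeftCLM_apply_apply (hasTemperateGrowth_weight s),
    SchwartzMap.smulLeftCLM_apply_apply (hasTemperateGrowth_weight (-s)), smul_smul,
    ← Real.rpow_add hbase]
  simp [neg_div]

lemma dense_weightedFourier_hasCompactSupport (s : ℝ) :
    Dense ((fun f ↦ (schwartzWeightedFourier s f).toLp 2 : 𝓢(R3, ℂ) → L2) ''
      {f | HasCompactSupport f}) := by
  refine DenseRange.dense_image ?_ (by fun_prop) dense_hasCompactSupport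
  exact (SchwartzMap.denseRange_toLpCLM (F := ℂ) (p := 2) (μ := (volume : Measure R3))
    ENNReal.ofNat_ne_top).comp (surjective_schwartzWeightedFourier s).denseRange
    (SchwartzMap.toLpCLM ℝ ℂ 2 (volume : Measure R3)).continuous

lemma exists_hasCompactSupport_tendsto_sobolevNorm {s : ℝ} {u : L2} (hu : sobolevNormSq s u < ⊤) :
    ∃ f : ℕ → 𝓢(R3, ℂ), (∀ n, HasCompactSupport (f n)) ∧
      Tendsto (fun n ↦ sobolevNorm s ((f n).toLp 2 volume - u)) atTop (𝓝 0) := by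
  have hmem : MemLp (weightedFourier s u) 2 volume :=
    ⟨aestronglyMeasurable_weightedFourier s u, sobolevNorm_lt_top.2 hu⟩
  obtain ⟨v, hv, hlim⟩ :=
    mem_closure_iff_seq_limit.1 (dense_weightedFourier_hasCompactSupport s (hmem.toLp _))
  choose f hf hfv using hv
  refine ⟨f, hf, (tendsto_iff_edist_tendsto_0.1 hlim).congr fun n ↦ ?_⟩
  rw [Lp.edist_def, sobolevNorm, ← hfv]
  refine eLpNorm_congr_ae ?_
  filter_upwards [weightedFourier_sub s ((f n).toLp 2 volume) u, weightedFourier_toLp s (f n),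
    hmem.coeFn_toLp, (schwartzWeightedFourier s (f n)).coeFn_toLp 2 volume] with ξ h₁ h₂ h₃ h₄
  rw [h₁, Pi.sub_apply, Pi.sub_apply, h₂, h₃, h₄]

end Sobolev

section LowerSemicontinuity

lemma eLpNorm_le_of_tendsto_Lp {α F : Type*} [MeasurableSpace α] [NormedAddCommGroup F]
    {μ : Measure α} {p : ℝ≥0∞} [Fact (1 ≤ p)] {f : ℕ → Lp F p μ} {g : Lp F p μ}
    (hf : Tendsto f atTop (𝓝 g)) {q : ℝ≥0∞} {B : ℕ → ℝ≥0∞} {b : ℝ≥0∞}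
    (hfB : ∀ n, eLpNorm (f n) q μ ≤ B n) (hB : Tendsto B atTop (𝓝 b)) :
    eLpNorm g q μ ≤ b := by
  obtain ⟨ns, hns, hae⟩ := (tendstoInMeasure_of_tendsto_Lp hf).exists_seq_tendsto_ae
  calc eLpNorm g q μ
      ≤ liminf (fun n ↦ eLpNorm (f (ns n)) q μ) atTop :=
        Lp.eLpNorm_lim_le_liminf_eLpNorm (fun n ↦ Lp.aestronglyMeasurable _) _ hae
    _ ≤ liminf (fun n ↦ B (ns n)) atTop := liminf_le_liminf (Eventually.of_forall fun n ↦ hfB _)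
    _ = b := (hB.comp hns.tendsto_atTop).liminf_eq

lemma eLpNorm_le_of_forall_hasCompactSupport {s : ℝ} (hs : 0 ≤ s) {u : L2}
    (hu : sobolevNormSq s u < ⊤) {q : ℝ≥0∞} {B : ℝ≥0∞ → ℝ≥0∞} (hB : ContinuousAt B 0)
    (h : ∀ f : 𝓢(R3, ℂ), HasCompactSupport f →
      eLpNorm f q volume ≤ B (sobolevNorm s (f.toLp 2 volume - u))) :
    eLpNorm u q volume ≤ B 0 := by
  obtain ⟨f, hf, hlim⟩ := exists_hasCompactSupport_tendsto_sobolevNorm hu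
  have hL2 : Tendsto (fun n ↦ (f n).toLp 2 (volume : Measure R3)) atTop (𝓝 u) := by
    rw [Lp.tendsto_Lp_iff_tendsto_eLpNorm']
    refine tendsto_of_tendsto_of_tendsto_of_le_of_le tendsto_const_nhds hlim
      (fun n ↦ zero_le) fun n ↦ ?_
    rw [← eLpNorm_congr_ae (Lp.coeFn_sub _ _)]
    exact eLpNorm_le_sobolevNorm hs _
  refine eLpNorm_le_of_tendsto_Lp hL2 (fun n ↦ ?_) (hB.tendsto.comp hlim)
  rw [eLpNorm_congr_ae ((f n).coeFn_toLp 2 volume)]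
  exact h (f n) (hf n)

end LowerSemicontinuity

section Interpolation

/-- The Sobolev inequality `‖u‖_{8/3} ≤ L ‖u‖_{H^{1/2}}` on `L²(ℝ³)`. -/
def SobolevInequality (L : ℝ≥0∞) : Prop :=
  ∀ u : L2, eLpNorm u (8 / 3) volume ≤ L * sobolevNorm (1 / 2) u

lemma coulomb_congr_ae {f g : R3 → ℂ} (h : f =ᵐ[volume] g) : coulomb f = coulomb g := by
  refine lintegral_congr_ae ?_
  filter_upwards [h] with x hx
  refine lintegral_congr_ae ?_
  filter_upwards [h] with y hy
  rw [hx, hy]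

lemma homSobolevNorm_le_sobolevNorm {s : ℝ} (hs : 0 ≤ s) (f : 𝓢(R3, ℂ)) :
    homSobolevNorm s f ≤ sobolevNorm s (f.toLp 2) := by
  rw [← ENNReal.pow_le_pow_left_iff two_ne_zero, sobolevNorm_sq, sobolevNormSq,
    SchwartzMap.toLp_fourier_eq, homSobolevNorm, ← ENNReal.rpow_natCast, ← ENNReal.rpow_mul]
  norm_num only [ENNReal.rpow_one]
  refine lintegral_mono_ae ?_
  filter_upwards [(𝓕 f).coeFn_toLp 2 volume] with ξ hξ
  rw [hξ, SchwartzMap.fourier_coe, Real.rpow_mul (norm_nonneg ξ), Real.rpow_two]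
  gcongr
  linarith

lemma le_mul_of_pow_eight_le {A κ n p : ℝ≥0∞} (hp : p ≠ ⊤)
    (h : p ^ 8 ≤ A * n ^ 4 * (n ^ 4 + κ * p ^ 4)) : p ≤ (1 + A * (1 + κ)) * n := by
  rcases le_total p n with hpn | hnp
  · exact hpn.trans (le_mul_of_one_le_left (zero_le) le_self_add)
  rcases eq_or_ne p 0 with rfl | hp₀
  · exact zero_le
  have hfour : p ^ 4 ≤ A * (1 + κ) * n ^ 4 := by
    rw [← ENNReal.mul_le_mul_iff_left (pow_ne_zero 4 hp₀) (ENNReal.pow_ne_top hp)]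
    calc p ^ 4 * p ^ 4 = p ^ 8 := by ring
      _ ≤ A * n ^ 4 * (n ^ 4 + κ * p ^ 4) := h
      _ ≤ A * n ^ 4 * (p ^ 4 + κ * p ^ 4) := by gcongr
      _ = A * (1 + κ) * n ^ 4 * p ^ 4 := by ring
  rw [← ENNReal.pow_le_pow_left_iff four_ne_zero, mul_pow]
  grw [hfour]
  gcongr
  exact le_add_self.trans (le_self_pow₀ le_self_add four_ne_zero)

lemma rpow_half_mul_rpow_eighth_pow_eight (a b : ℝ≥0∞) :
    (a ^ (1 / 2 : ℝ) * b ^ (1 / 8 : ℝ)) ^ 8 = a ^ 4 * b := by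
  rw [mul_pow, ← ENNReal.rpow_mul_natCast, ← ENNReal.rpow_mul_natCast, ← ENNReal.rpow_natCast a 4]
  norm_num

variable {C L : ℝ≥0∞}

lemma eLpNorm_le_of_hasCompactSupport (hC : InterpolationInequality C) {f : 𝓢(R3, ℂ)}
    (hf : HasCompactSupport f) :
    eLpNorm f (8 / 3) volume ≤
      C * sobolevNorm (1 / 2) (f.toLp 2) ^ (1 / 2 : ℝ) * coulomb f ^ (1 / 8 : ℝ) := by
  refine (hC f (f.smooth ⊤) hf).trans ?_
  gcongr
  exact homSobolevNorm_le_sobolevNorm (by norm_num) f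

/-- The Coulomb energy is itself controlled by `‖f‖₂` and `‖f‖_{8/3}`, the latter with a power
small enough to be absorbed into the left-hand side. -/
lemma eLpNorm_le_mul_sobolevNorm_of_hasCompactSupport (hC : InterpolationInequality C)
    {f : 𝓢(R3, ℂ)} (hf : HasCompactSupport f) :
    eLpNorm f (8 / 3) volume ≤
      (1 + C ^ 8 * (1 + coulombConstant)) * sobolevNorm (1 / 2) (f.toLp 2) := by
  set N := sobolevNorm (1 / 2) (f.toLp 2)
  set P := eLpNorm f (8 / 3) volume
  refine le_mul_of_pow_eight_le (f.memLp (8 / 3) volume).eLpNorm_ne_top ?_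
  have hmass : eLpNorm f 2 volume ≤ N := by
    rw [← eLpNorm_congr_ae (f.coeFn_toLp 2 volume)]
    exact eLpNorm_le_sobolevNorm (by norm_num) _
  have hcoulomb : coulomb f ≤ N ^ 4 + coulombConstant * P ^ 4 :=
    calc coulomb f ≤ _ := coulombInteraction_le f.continuous.measurable f.continuous.measurable
      _ ≤ N ^ 2 * N ^ 2 + coulombConstant * P ^ 2 * P ^ 2 := by grw [hmass]
      _ = N ^ 4 + coulombConstant * P ^ 4 := by ring
  calc P ^ 8 ≤ (C * N ^ (1 / 2 : ℝ) * coulomb f ^ (1 / 8 : ℝ)) ^ 8 := by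
        grw [← eLpNorm_le_of_hasCompactSupport hC hf]
    _ = C ^ 8 * N ^ 4 * coulomb f := by
        rw [mul_assoc, mul_pow, rpow_half_mul_rpow_eighth_pow_eight, mul_assoc]
    _ ≤ C ^ 8 * N ^ 4 * (N ^ 4 + coulombConstant * P ^ 4) := by grw [hcoulomb]

lemma exists_sobolevInequality (h : bestConstant ≠ ⊤) : ∃ L ≠ ⊤, SobolevInequality L := by
  obtain ⟨C, ⟨_, hC⟩, hC_top⟩ := sInf_lt_iff.1 h.lt_top
  have hκ := coulombConstant_ne_top
  set L := 1 + C ^ 8 * (1 + coulombConstant)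
  have hL : L ≠ ⊤ := by finiteness
  refine ⟨L, hL, fun u ↦ ?_⟩
  rcases eq_or_ne (sobolevNorm (1 / 2) u) ⊤ with hu | hu
  · rw [hu, ENNReal.mul_top (by positivity)]
    exact le_top
  have hcont : Continuous fun ε ↦ L * (sobolevNorm (1 / 2) u + ε) :=
    (ENNReal.continuous_const_mul hL).comp (by fun_prop)
  simpa using eLpNorm_le_of_forall_hasCompactSupport (q := 8 / 3) (by norm_num)
    (sobolevNorm_lt_top.1 hu.lt_top) hcont.continuousAt fun f hf ↦
      (eLpNorm_le_mul_sobolevNorm_of_hasCompactSupport hC hf).trans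
        (by grw [← sobolevNorm_le_add (1 / 2) u])

lemma sqrt_coulombInteraction_le (hL : SobolevInequality L) (u v : L2) :
    coulombInteraction u v ^ (1 / 2 : ℝ) ≤
      (1 + coulombConstant * L ^ 4) ^ (1 / 2 : ℝ) *
        (sobolevNorm (1 / 2) u * sobolevNorm (1 / 2) v) := by
  set N := sobolevNorm (1 / 2) u
  set M := sobolevNorm (1 / 2) v
  have hle : coulombInteraction u v ≤ (1 + coulombConstant * L ^ 4) * (N * M) ^ 2 :=
    calc coulombInteraction u v
        ≤ N ^ 2 * M ^ 2 + coulombConstant * (L * N) ^ 2 * (L * M) ^ 2 := by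
          grw [coulombInteraction_le (Lp.stronglyMeasurable u).measurable
            (Lp.stronglyMeasurable v).measurable, hL u, hL v,
            eLpNorm_le_sobolevNorm (s := 1 / 2) (by norm_num) u,
            eLpNorm_le_sobolevNorm (s := 1 / 2) (by norm_num) v]
      _ = (1 + coulombConstant * L ^ 4) * (N * M) ^ 2 := by ring
  grw [hle, ENNReal.mul_rpow_of_nonneg _ _ (by norm_num), ← ENNReal.rpow_natCast_mul]
  norm_num

lemma sqrt_coulomb_le_add (hL : SobolevInequality L) (u v : L2) :
    coulomb v ^ (1 / 2 : ℝ) ≤ coulomb u ^ (1 / 2 : ℝ) +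
      (1 + coulombConstant * L ^ 4) ^ (1 / 2 : ℝ) * (sobolevNorm (1 / 2) (v - u) *
        (2 * sobolevNorm (1 / 2) u + sobolevNorm (1 / 2) (v - u))) := by
  have hsub (w : L2) :
      coulombInteraction (v - u : R3 → ℂ) w = coulombInteraction (v - u : L2) w := by
    refine lintegral_congr_ae ?_
    filter_upwards [Lp.coeFn_sub v u] with x hx
    rw [hx]
  have h := sqrt_coulomb_le (Lp.stronglyMeasurable v).measurable
    (Lp.stronglyMeasurable u).measurable
  rw [hsub, hsub] at h
  grw [h, sqrt_coulombInteraction_le hL, sqrt_coulombInteraction_le hL, sobolevNorm_le_add _ u v]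
  exact le_of_eq (by ring)

lemma coulomb_ne_top (hL : SobolevInequality L) (hL_top : L ≠ ⊤) {u : L2}
    (hu : sobolevNormSq (1 / 2) u < ⊤) : coulomb u ≠ ⊤ := by
  have hκ := coulombConstant_ne_top
  have hN := (sobolevNorm_lt_top.2 hu).ne
  have hroot : coulomb u ^ (1 / 2 : ℝ) ≠ ⊤ :=
    ne_top_of_le_ne_top (by finiteness) (sqrt_coulombInteraction_le hL u u)
  simpa using hroot

lemma eLpNorm_le_of_sobolevNormSq_lt_top (hC : InterpolationInequality C) (hC_top : C ≠ ⊤)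
    (hL : SobolevInequality L) (hL_top : L ≠ ⊤) {u : L2} (hu : sobolevNormSq (1 / 2) u < ⊤) :
    eLpNorm u (8 / 3) volume ≤
      C * sobolevNorm (1 / 2) u ^ (1 / 2 : ℝ) * coulomb u ^ (1 / 8 : ℝ) := by
  have hκ := coulombConstant_ne_top
  set N := sobolevNorm (1 / 2) u
  have hN : N ≠ ⊤ := (sobolevNorm_lt_top.2 hu).ne
  set K := (1 + coulombConstant * L ^ 4) ^ (1 / 2 : ℝ)
  have hK : K ≠ ⊤ := by finiteness
  set R := coulomb u ^ (1 / 2 : ℝ)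
  have hR : R ≠ ⊤ := ENNReal.rpow_ne_top_of_nonneg (by norm_num) (coulomb_ne_top hL hL_top hu)
  have hroot (g : R3 → ℂ) : (coulomb g ^ (1 / 2 : ℝ)) ^ (1 / 4 : ℝ) = coulomb g ^ (1 / 8 : ℝ) := by
    rw [← ENNReal.rpow_mul]
    norm_num
  let B (ε : ℝ≥0∞) : ℝ≥0∞ :=
    C * (N + ε) ^ (1 / 2 : ℝ) * (R + K * (ε * (2 * N + ε))) ^ (1 / 4 : ℝ)
  have hB : ContinuousAt B 0 := by
    have hadd (a : ℝ≥0∞) : Tendsto (fun ε ↦ a + ε) (𝓝 0) (𝓝 (a + 0)) :=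
      tendsto_const_nhds.add tendsto_id
    have hmul : Tendsto (fun ε ↦ ε * (2 * N + ε)) (𝓝 0) (𝓝 (0 * (2 * N + 0))) :=
      ENNReal.Tendsto.mul tendsto_id (.inr (by finiteness)) (hadd _) (.inr (by finiteness))
    refine ENNReal.Tendsto.mul (ENNReal.Tendsto.const_mul ((hadd N).ennrpow_const _)
      (.inr hC_top)) (.inr (by finiteness)) ?_ (.inr (by finiteness))
    exact (tendsto_const_nhds.add (ENNReal.Tendsto.const_mul hmul (.inr hK))).ennrpow_const _
  have hle := eLpNorm_le_of_forall_hasCompactSupport (q := 8 / 3) (by norm_num) hu hB fun f hf ↦ ?_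
  · simpa only [B, R, add_zero, zero_mul, mul_zero, hroot] using hle
  · grw [eLpNorm_le_of_hasCompactSupport hC hf, ← hroot, sobolevNorm_le_add _ u,
      ← coulomb_congr_ae (f.coeFn_toLp 2 volume), sqrt_coulomb_le_add hL u]

lemma eLpNorm_le_bestConstant_mul (h : bestConstant ≠ ⊤) {u : L2}
    (hu : sobolevNormSq (1 / 2) u < ⊤) :
    eLpNorm u (8 / 3) volume ≤
      bestConstant * (sobolevNorm (1 / 2) u ^ (1 / 2 : ℝ) * coulomb u ^ (1 / 8 : ℝ)) := by
  obtain ⟨L, hL_top, hL⟩ := exists_sobolevInequality h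
  have hN : sobolevNorm (1 / 2) u ≠ ⊤ := (sobolevNorm_lt_top.2 hu).ne
  have hD := coulomb_ne_top hL hL_top hu
  have hX : sobolevNorm (1 / 2) u ^ (1 / 2 : ℝ) * coulomb u ^ (1 / 8 : ℝ) ≠ ⊤ := by finiteness
  rw [← ENNReal.div_le_iff_le_mul (.inr h) (.inl hX)]
  refine le_sInf fun C ⟨_, hC⟩ ↦ ?_
  rcases eq_or_ne C ⊤ with rfl | hC_top
  · exact le_top
  rw [ENNReal.div_le_iff_le_mul (.inr hC_top) (.inl hX), ← mul_assoc]
  exact eLpNorm_le_of_sobolevNormSq_lt_top hC hC_top hL hL_top hu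

end Interpolation

section Dilation

lemma lintegral_comp_smul {E : Type*} [NormedAddCommGroup E] [NormedSpace ℝ E] [MeasurableSpace E]
    [BorelSpace E] [FiniteDimensional ℝ E] (μ : Measure E) [μ.IsAddHaarMeasure] (f : E → ℝ≥0∞)
    {l : ℝ} (hl : l ≠ 0) :
    ∫⁻ x, f (l • x) ∂μ = ENNReal.ofReal |(l ^ Module.finrank ℝ E)⁻¹| * ∫⁻ x, f x ∂μ := by
  rw [← smul_eq_mul, ← lintegral_smul_measure, ← Measure.map_addHaar_smul μ hl]
  exact (lintegral_map_equiv f (Homeomorph.smulOfNeZero l hl).toMeasurableEquiv).symm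

lemma fourier_comp_smul {V F : Type*} [NormedAddCommGroup V] [InnerProductSpace ℝ V]
    [MeasurableSpace V] [BorelSpace V] [FiniteDimensional ℝ V] [NormedAddCommGroup F]
    [NormedSpace ℂ F] (f : V → F) {l : ℝ} (hl : l ≠ 0) (ξ : V) :
    𝓕 (fun x ↦ f (l • x)) ξ = |(l ^ Module.finrank ℝ V)⁻¹| • 𝓕 f (l⁻¹ • ξ) := by
  rw [Real.fourier_eq, Real.fourier_eq, ← Measure.integral_comp_smul]
  simp [inner_smul_left, inner_smul_right, hl]

/-- The rescaled function `c f(l x)`. -/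
def dilate (c l : ℝ) (f : R3 → ℂ) (x : R3) : ℂ := c • f (l • x)

lemma exists_schwartz_eq_dilate (c : ℝ) {l : ℝ} (hl : l ≠ 0) (f : 𝓢(R3, ℂ)) :
    ∃ g : 𝓢(R3, ℂ), ⇑g = dilate c l f :=
  ⟨c • SchwartzMap.compCLMOfContinuousLinearEquiv ℝ
    (ContinuousLinearEquiv.smulLeft (R₁ := ℝ) (M₁ := R3) (Units.mk0 l hl)) f, rfl⟩

variable {c l : ℝ}

lemma lintegral_dilate_rpow (hc : 0 ≤ c) (hl : 0 < l) (f : R3 → ℂ) {p : ℝ} (hp : 0 ≤ p) :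
    ∫⁻ x, ‖dilate c l f x‖ₑ ^ p = ENNReal.ofReal (c ^ p * (l ^ 3)⁻¹) * ∫⁻ x, ‖f x‖ₑ ^ p := by
  simp only [dilate, enorm_smul, Real.enorm_of_nonneg hc, ENNReal.mul_rpow_of_nonneg _ _ hp]
  rw [lintegral_const_mul' _ _ (by finiteness),
    lintegral_comp_smul volume (fun x ↦ ‖f x‖ₑ ^ p) hl.ne', finrank_euclideanSpace_fin,
    abs_of_pos (by positivity), ENNReal.ofReal_mul (by positivity),
    ENNReal.ofReal_rpow_of_nonneg hc hp, mul_assoc]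

lemma coulomb_dilate (hc : 0 ≤ c) (hl : 0 < l) (f : R3 → ℂ) :
    coulomb (dilate c l f) = ENNReal.ofReal (c ^ 4 * (l ^ 5)⁻¹) * coulomb f := by
  have hl₀ : ENNReal.ofReal l ≠ 0 := by simpa using hl
  have hscale (x y : R3) : ‖dilate c l f x‖ₑ ^ 2 * ‖dilate c l f y‖ₑ ^ 2 / ‖x - y‖ₑ =
      ENNReal.ofReal (c ^ 4 * l) *
        (‖f (l • x)‖ₑ ^ 2 * ‖f (l • y)‖ₑ ^ 2 / ‖l • x - l • y‖ₑ) := by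
    rw [dilate, dilate, ← smul_sub, enorm_smul, enorm_smul, enorm_smul, Real.enorm_of_nonneg hc,
      Real.enorm_of_nonneg hl.le, ENNReal.ofReal_mul (by positivity), ENNReal.ofReal_pow hc,
      ← ENNReal.mul_div_mul_left _ _ hl₀ ENNReal.ofReal_ne_top]
    simp only [div_eq_mul_inv]
    ring
  have hinner (x : R3) :
      ∫⁻ y, ‖f (l • x)‖ₑ ^ 2 * ‖f (l • y)‖ₑ ^ 2 / ‖l • x - l • y‖ₑ =
        ENNReal.ofReal |(l ^ 3)⁻¹| * ∫⁻ y, ‖f (l • x)‖ₑ ^ 2 * ‖f y‖ₑ ^ 2 / ‖l • x - y‖ₑ := by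
    simpa using lintegral_comp_smul volume
      (fun y ↦ ‖f (l • x)‖ₑ ^ 2 * ‖f y‖ₑ ^ 2 / ‖l • x - y‖ₑ) hl.ne'
  have houter := lintegral_comp_smul volume
    (fun x ↦ ∫⁻ y, ‖f x‖ₑ ^ 2 * ‖f y‖ₑ ^ 2 / ‖x - y‖ₑ) hl.ne'
  simp only [coulomb, hscale, lintegral_const_mul' _ _ ENNReal.ofReal_ne_top, hinner, houter,
    finrank_euclideanSpace_fin]
  rw [← mul_assoc, ← mul_assoc, ← ENNReal.ofReal_mul (by positivity),
    ← ENNReal.ofReal_mul (by positivity), abs_of_pos (by positivity)]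
  congr 2
  field_simp

lemma homSobolevNorm_sq (s : ℝ) (f : R3 → ℂ) :
    homSobolevNorm s f ^ 2 = ∫⁻ ξ, ENNReal.ofReal (‖ξ‖ ^ (2 * s)) * ‖𝓕 f ξ‖ₑ ^ 2 := by
  rw [homSobolevNorm, ← ENNReal.rpow_mul_natCast]
  norm_num

lemma fourier_dilate (hl : l ≠ 0) (c : ℝ) (f : R3 → ℂ) (ξ : R3) :
    𝓕 (dilate c l f) ξ = (c * |(l ^ 3)⁻¹|) • 𝓕 f (l⁻¹ • ξ) := by
  have hsmul : 𝓕 (dilate c l f) ξ = c • 𝓕 (fun x ↦ f (l • x)) ξ := by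
    simp only [Real.fourier_eq, dilate, ← integral_smul, smul_comm c]
  rw [hsmul, fourier_comp_smul f hl, finrank_euclideanSpace_fin, smul_smul]

lemma homSobolevNorm_sq_dilate (hl : 0 < l) (s c : ℝ) (f : R3 → ℂ) :
    homSobolevNorm s (dilate c l f) ^ 2 =
      ENNReal.ofReal (c ^ 2 * l ^ (2 * s - 3)) * homSobolevNorm s f ^ 2 := by
  have hscale (ξ : R3) : ENNReal.ofReal (‖ξ‖ ^ (2 * s)) * ‖𝓕 (dilate c l f) ξ‖ₑ ^ 2 =
      ENNReal.ofReal (c ^ 2 * (l ^ 6)⁻¹ * l ^ (2 * s)) *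
        (ENNReal.ofReal (‖l⁻¹ • ξ‖ ^ (2 * s)) * ‖𝓕 f (l⁻¹ • ξ)‖ₑ ^ 2) := by
    have hnorm : l ^ (2 * s) * ‖l⁻¹ • ξ‖ ^ (2 * s) = ‖ξ‖ ^ (2 * s) := by
      rw [← Real.mul_rpow hl.le (norm_nonneg _), norm_smul, norm_inv, Real.norm_of_nonneg hl.le,
        mul_inv_cancel_left₀ hl.ne']
    rw [fourier_dilate hl.ne', enorm_smul, mul_pow, ← enorm_pow, Real.enorm_of_nonneg (sq_nonneg _),
      mul_pow, sq_abs, ← mul_assoc, ← mul_assoc, ← ENNReal.ofReal_mul (by positivity),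
      ← ENNReal.ofReal_mul (by positivity), ← hnorm]
    congr 2
    ring
  simp only [homSobolevNorm_sq, hscale, lintegral_const_mul' _ _ ENNReal.ofReal_ne_top]
  rw [lintegral_comp_smul volume (fun ξ ↦ ENNReal.ofReal (‖ξ‖ ^ (2 * s)) * ‖𝓕 f ξ‖ₑ ^ 2)
    (inv_ne_zero hl.ne'), ← mul_assoc, ← ENNReal.ofReal_mul (by positivity),
    finrank_euclideanSpace_fin, abs_of_pos (by positivity), Real.rpow_sub hl]
  congr 2
  norm_num
  field_simp

lemma sobolevNormSq_toLp_le {s : ℝ} (hs₀ : 0 ≤ s) (hs₁ : s ≤ 1) (f : 𝓢(R3, ℂ)) :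
    sobolevNormSq s (f.toLp 2) ≤ eLpNorm f 2 volume ^ 2 + homSobolevNorm s f ^ 2 := by
  have hF := (𝓕 f : 𝓢(R3, ℂ)).coeFn_toLp 2 (volume : Measure R3)
  have plancherel : eLpNorm f 2 volume = eLpNorm (𝓕 f : 𝓢(R3, ℂ)) 2 volume := by
    rw [← eLpNorm_congr_ae (f.coeFn_toLp 2 volume), ← eLpNorm_congr_ae hF,
      ← SchwartzMap.toLp_fourier_eq, eLpNorm_fourier]
  have hmeas : Measurable (𝓕 f : 𝓢(R3, ℂ)) := (𝓕 f).continuous.measurable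
  rw [plancherel, eLpNorm_two_sq, homSobolevNorm_sq, sobolevNormSq, SchwartzMap.toLp_fourier_eq,
    ← lintegral_add_left (by fun_prop)]
  refine lintegral_mono_ae ?_
  filter_upwards [hF] with ξ hξ
  have hweight : (1 + ‖ξ‖ ^ 2) ^ s ≤ 1 + ‖ξ‖ ^ (2 * s) := by
    simpa [Real.rpow_mul] using
      Real.rpow_add_le_add_rpow zero_le_one (sq_nonneg ‖ξ‖) hs₀ hs₁
  grw [hξ, ← SchwartzMap.fourier_coe, hweight, ENNReal.ofReal_add zero_le_one (by positivity)]
  simp [add_mul]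

end Dilation

section Energy

lemma eLpNorm_eight_thirds_pow_eight {α F : Type*} [MeasurableSpace α] [NormedAddCommGroup F]
    (μ : Measure α) (f : α → F) :
    eLpNorm f (8 / 3) μ ^ 8 = (∫⁻ x, ‖f x‖ₑ ^ (8 / 3 : ℝ) ∂μ) ^ 3 := by
  rw [pow_mul _ 2 4, eLpNorm_eight_thirds_sq, ← ENNReal.rpow_mul_natCast, ← ENNReal.rpow_natCast]
  norm_num

lemma integral_norm_sq_eq_toReal {α F : Type*} [MeasurableSpace α] [NormedAddCommGroup F]
    {μ : Measure α} {f : α → F} (hf : AEStronglyMeasurable f μ) :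
    ∫ x, ‖f x‖ ^ 2 ∂μ = (eLpNorm f 2 μ ^ 2).toReal := by
  have hmeas : AEStronglyMeasurable (fun x ↦ ‖f x‖ ^ 2) μ := hf.norm.pow 2
  rw [eLpNorm_two_sq, integral_eq_lintegral_of_nonneg_ae (ae_of_all _ fun x ↦ by positivity) hmeas]
  simp only [ENNReal.ofReal_pow (norm_nonneg _), ofReal_norm]

lemma eq_bot_of_forall_le_add_mul {a : EReal} {b c : ℝ} (hc : c < 0)
    (h : ∀ l : ℝ, 0 < l → a ≤ ((b + l * c : ℝ) : EReal)) : a = ⊥ := by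
  rw [EReal.eq_bot_iff_forall_lt]
  intro y
  obtain ⟨l, hl, hly⟩ : ∃ l : ℝ, 0 < l ∧ b + l * c < y :=
    ((eventually_gt_atTop 0).and <| (tendsto_atBot_add_const_left _ b
      (tendsto_id.atTop_mul_const_of_neg hc)).eventually_lt_atBot y).exists
  exact (h l hl).trans_lt (EReal.coe_lt_coe hly)

variable {α β : ℝ}

lemma energy_eq_coe {p : ℝ} {u : L2} (hT : sobolevNormSq (1 / 2) u ≠ ⊤) (hD : coulomb u ≠ ⊤)
    (hP : ∫⁻ x, ‖u x‖ₑ ^ p ≠ ⊤) :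
    energy p α β u = ((1 / 2 * (sobolevNormSq (1 / 2) u).toReal + α * (coulomb u).toReal -
      β * (∫⁻ x, ‖u x‖ₑ ^ p).toReal : ℝ) : EReal) := by
  rw [energy]
  lift sobolevNormSq (1 / 2) u to NNReal using hT with T
  lift coulomb u to NNReal using hD with D
  lift ∫⁻ x, ‖u x‖ₑ ^ p to NNReal using hP with P
  rfl

/-- The value `(27α / β³)^{1/8} / √2` with which `S` is compared. -/
def criticalConstant (α β : ℝ) : ℝ := (27 * α / β ^ 3) ^ (1 / 8 : ℝ) / √2

lemma criticalConstant_pos (hα : 0 < α) (hβ : 0 < β) : 0 < criticalConstant α β := by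
  unfold criticalConstant
  positivity

lemma criticalConstant_pow_eight (hα : 0 ≤ α) (hβ : 0 ≤ β) :
    criticalConstant α β ^ 8 = 27 * α / (16 * β ^ 3) := by
  have hsqrt : √2 ^ 8 = 16 := by
    rw [pow_mul _ 2 4, Real.sq_sqrt zero_le_two]
    norm_num
  rw [criticalConstant, div_pow, hsqrt, ← Real.rpow_mul_natCast (by positivity)]
  norm_num [div_div, mul_comm]

lemma ofReal_criticalConstant_lt {S : ℝ≥0∞} :
    ENNReal.ofReal (criticalConstant α β) < S ↔
      ENNReal.ofReal ((27 * α / β ^ 3) ^ (1 / 8 : ℝ)) < ENNReal.ofReal √2 * S := by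
  rw [criticalConstant, ENNReal.ofReal_div_of_pos (by positivity),
    ENNReal.div_lt_iff (by simp) (by simp), mul_comm S]

variable {T D P : ℝ}

/-- The arithmetic–geometric mean inequality for `T / 4`, `T / 4` and `α D`. -/
lemma mul_le_half_add_of_cube_le (hα : 0 ≤ α) (hT : 0 ≤ T) (hD : 0 ≤ D)
    (h : 16 * β ^ 3 * P ^ 3 ≤ 27 * α * T ^ 2 * D) : β * P ≤ 1 / 2 * T + α * D := by
  have hb : 0 ≤ α * D := by positivity
  have amgm : 27 * (T / 4) ^ 2 * (α * D) ≤ (1 / 2 * T + α * D) ^ 3 := by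
    generalize α * D = b at hb
    obtain ⟨a, rfl⟩ : ∃ a, T = 4 * a := ⟨T / 4, by ring⟩
    have ha : 0 ≤ a := by linarith
    nlinarith [mul_nonneg (by positivity : 0 ≤ 8 * a + b) (sq_nonneg (a - b))]
  have hcube : (β * P) ^ 3 ≤ (1 / 2 * T + α * D) ^ 3 := by linarith
  exact le_of_pow_le_pow_left₀ three_ne_zero (by positivity) hcube

lemma exists_amplitude_of_pos (hα : 0 < α) (hT : 0 < T) (hD : 0 < D)
    (h : 27 * α * T ^ 2 * D < 16 * β ^ 3 * P ^ 3) :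
    ∃ s : ℝ, 0 < s ∧ 1 / 2 * T + α * s ^ 3 * D - β * s * P < 0 := by
  -- Equality in the arithmetic–geometric mean inequality: `α s³ D = T / 4`.
  have hq : 0 < T / (4 * α * D) := by positivity
  have hroot : ((T / (4 * α * D)) ^ (1 / 3 : ℝ)) ^ 3 = T / (4 * α * D) := by
    rw [← Real.rpow_mul_natCast hq.le]
    norm_num
  refine ⟨(T / (4 * α * D)) ^ (1 / 3 : ℝ), by positivity, ?_⟩
  set s := (T / (4 * α * D)) ^ (1 / 3 : ℝ)
  have hbalance : α * s ^ 3 * D = T / 4 := by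
    rw [hroot]
    field_simp
  have hcube : (3 / 4 * T) ^ 3 < (β * s * P) ^ 3 := by
    have hpow : (β * s * P) ^ 3 = β ^ 3 * P ^ 3 * (T / (4 * α * D)) := by
      rw [← hroot]
      ring
    rw [hpow, mul_div_assoc', lt_div_iff₀ (by positivity)]
    linarith [mul_lt_mul_of_pos_left h hT]
  have := (Odd.pow_lt_pow (by decide)).1 hcube
  linarith

lemma exists_amplitude (hα : 0 < α) (hT : 0 ≤ T) (hD : 0 ≤ D)
    (h : 27 * α * T ^ 2 * D < 16 * β ^ 3 * P ^ 3) :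
    ∃ s : ℝ, 0 < s ∧ 1 / 2 * T + α * s ^ 3 * D - β * s * P < 0 := by
  have hcont : ContinuousAt (fun ε : ℝ ↦ 27 * α * (T + ε) ^ 2 * (D + ε)) 0 := by fun_prop
  have hnear : ∀ᶠ ε in 𝓝[>] 0, 27 * α * (T + ε) ^ 2 * (D + ε) < 16 * β ^ 3 * P ^ 3 :=
    (hcont.mono_left nhdsWithin_le_nhds).eventually_lt_const (by simpa using h)
  obtain ⟨ε, hlt, hε : 0 < ε⟩ := (hnear.and self_mem_nhdsWithin).exists
  obtain ⟨s, hs, hneg⟩ := exists_amplitude_of_pos hα (by positivity) (by positivity) hlt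
  have hextra : 0 ≤ 1 / 2 * ε + α * s ^ 3 * ε := by positivity
  exact ⟨s, hs, by linarith⟩

lemma energy_nonneg (hα : 0 < α) (hβ : 0 < β)
    (h : bestConstant ≤ ENNReal.ofReal (criticalConstant α β)) {u : L2}
    (hu : sobolevNormSq (1 / 2) u < ⊤) : 0 ≤ energy (8 / 3) α β u := by
  have hS := ne_top_of_le_ne_top ENNReal.ofReal_ne_top h
  obtain ⟨L, hL_top, hL⟩ := exists_sobolevInequality hS
  have hD := coulomb_ne_top hL hL_top hu
  have hcube : (∫⁻ x, ‖u x‖ₑ ^ (8 / 3 : ℝ)) ^ 3 ≤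
      ENNReal.ofReal (27 * α / (16 * β ^ 3)) * (sobolevNormSq (1 / 2) u ^ 2 * coulomb u) :=
    calc _ = eLpNorm u (8 / 3) volume ^ 8 := (eLpNorm_eight_thirds_pow_eight volume u).symm
      _ ≤ (ENNReal.ofReal (criticalConstant α β) *
            (sobolevNorm (1 / 2) u ^ (1 / 2 : ℝ) * coulomb u ^ (1 / 8 : ℝ))) ^ 8 := by
          grw [eLpNorm_le_bestConstant_mul hS hu, h]
      _ = _ := by
          rw [mul_pow, rpow_half_mul_rpow_eighth_pow_eight, ← sobolevNorm_sq, ← pow_mul,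
            ← ENNReal.ofReal_pow (criticalConstant_pos hα hβ).le,
            criticalConstant_pow_eight hα.le hβ.le]
  have hP : ∫⁻ x, ‖u x‖ₑ ^ (8 / 3 : ℝ) ≠ ⊤ := by
    have := ne_top_of_le_ne_top (by finiteness) hcube
    simpa using this
  have hreal := ENNReal.toReal_mono (by finiteness) hcube
  rw [ENNReal.toReal_pow, ENNReal.toReal_mul, ENNReal.toReal_mul, ENNReal.toReal_pow,
    ENNReal.toReal_ofReal (by positivity), div_mul_eq_mul_div, le_div_iff₀ (by positivity)] at hreal
  rw [energy_eq_coe hu.ne hD hP, EReal.coe_nonneg, sub_nonneg]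
  exact mul_le_half_add_of_cube_le hα.le ENNReal.toReal_nonneg ENNReal.toReal_nonneg
    (by linarith)

lemma exists_schwartz_of_lt_bestConstant {c : ℝ≥0∞} (hc : 0 < c) (h : c < bestConstant) :
    ∃ f : 𝓢(R3, ℂ), c ^ 8 * ((homSobolevNorm (1 / 2) f ^ 2) ^ 2 * coulomb f) <
      (∫⁻ x, ‖f x‖ₑ ^ (8 / 3 : ℝ)) ^ 3 := by
  have hfail : ¬ InterpolationInequality c := fun hc' ↦ notMem_of_lt_csInf' h ⟨hc, hc'⟩
  simp only [InterpolationInequality, not_forall, not_le] at hfail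
  obtain ⟨φ, hsmooth, hsupp, hφ⟩ := hfail
  refine ⟨hsupp.toSchwartzMap hsmooth, ?_⟩
  have hpow := ENNReal.pow_lt_pow_left (n := 8) (by norm_num) hφ
  rwa [mul_assoc, mul_pow, rpow_half_mul_rpow_eighth_pow_eight, eLpNorm_eight_thirds_pow_eight,
    pow_mul _ 2 2] at hpow

/-- The witness is `(s l)^{3/2} f(l x)`. -/
lemma exists_rescaling (f : 𝓢(R3, ℂ)) {s l : ℝ} (hs : 0 < s) (hl : 0 < l) :
    ∃ g : 𝓢(R3, ℂ),
      eLpNorm g 2 volume ^ 2 = ENNReal.ofReal (s ^ 3) * eLpNorm f 2 volume ^ 2 ∧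
      homSobolevNorm (1 / 2) g ^ 2 =
        ENNReal.ofReal (s ^ 3 * l) * homSobolevNorm (1 / 2) f ^ 2 ∧
      coulomb g = ENNReal.ofReal (s ^ 6 * l) * coulomb f ∧
      ∫⁻ x, ‖g x‖ₑ ^ (8 / 3 : ℝ) =
        ENNReal.ofReal (s ^ 4 * l) * ∫⁻ x, ‖f x‖ₑ ^ (8 / 3 : ℝ) := by
  obtain ⟨g, hg⟩ := exists_schwartz_eq_dilate ((s * l) ^ (3 / 2 : ℝ)) hl.ne' f
  have hsl : 0 ≤ s * l := by positivity
  have hc : 0 ≤ (s * l) ^ (3 / 2 : ℝ) := by positivity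
  have hpow (n : ℕ) : ((s * l) ^ (3 / 2 : ℝ)) ^ (2 * n) = (s * l) ^ (3 * n) := by
    rw [← Real.rpow_mul_natCast hsl, ← Real.rpow_natCast]
    congr 1
    push_cast
    ring
  refine ⟨g, ?_, ?_, ?_, ?_⟩
  · have h := lintegral_dilate_rpow hc hl f zero_le_two
    simp only [ENNReal.rpow_two, Real.rpow_two] at h
    rw [hg, eLpNorm_two_sq, eLpNorm_two_sq, h, hpow 1]
    congr 2
    field_simp
    ring
  · rw [hg, homSobolevNorm_sq_dilate hl, hpow 1]
    congr 2
    norm_num [Real.rpow_neg hl.le]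
    field_simp
  · rw [hg, coulomb_dilate hc hl, hpow 2]
    congr 2
    field_simp
    ring
  · rw [hg, lintegral_dilate_rpow hc hl f (by norm_num), ← Real.rpow_mul hsl]
    congr 2
    norm_num
    field_simp

lemma homSobolevNorm_ne_top (f : 𝓢(R3, ℂ)) {s : ℝ} (hs : 0 ≤ s) : homSobolevNorm s f ≠ ⊤ := by
  refine ne_top_of_le_ne_top ?_ (homSobolevNorm_le_sobolevNorm hs f)
  rw [sobolevNorm_toLp]
  exact ((schwartzWeightedFourier s f).memLp 2 volume).eLpNorm_ne_top

lemma coulomb_schwartz_ne_top (f : 𝓢(R3, ℂ)) : coulomb f ≠ ⊤ := by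
  have hκ := coulombConstant_ne_top
  have h₂ := (f.memLp 2 volume).eLpNorm_ne_top
  have h₃ := (f.memLp (8 / 3) volume).eLpNorm_ne_top
  have hle : coulomb f ≤ _ := coulombInteraction_le f.continuous.measurable f.continuous.measurable
  exact ne_top_of_le_ne_top (by finiteness) hle

lemma lintegral_eight_thirds_schwartz_ne_top (f : 𝓢(R3, ℂ)) :
    ∫⁻ x, ‖f x‖ₑ ^ (8 / 3 : ℝ) ≠ ⊤ := by
  have h := (f.memLp (8 / 3) volume).eLpNorm_ne_top
  have hpow : eLpNorm f (8 / 3) volume ^ 8 ≠ ⊤ := by finiteness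
  simpa [eLpNorm_eight_thirds_pow_eight] using hpow

lemma minEnergy_schwartz_le (f : 𝓢(R3, ℂ)) :
    minEnergy (8 / 3) α β (eLpNorm f 2 volume ^ 2).toReal ≤
      ((1 / 2 * ((eLpNorm f 2 volume ^ 2).toReal + (homSobolevNorm (1 / 2) f ^ 2).toReal) +
        α * (coulomb f).toReal - β * (∫⁻ x, ‖f x‖ₑ ^ (8 / 3 : ℝ)).toReal : ℝ) : EReal) := by
  have hf := f.coeFn_toLp 2 (volume : Measure R3)
  have hM : eLpNorm f 2 volume ^ 2 ≠ ⊤ := ENNReal.pow_ne_top (f.memLp 2 volume).eLpNorm_ne_top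
  have hK : homSobolevNorm (1 / 2) f ^ 2 ≠ ⊤ :=
    ENNReal.pow_ne_top (homSobolevNorm_ne_top f (by norm_num))
  have hT := sobolevNormSq_toLp_le (s := 1 / 2) (by norm_num) (by norm_num) f
  have hT_top : sobolevNormSq (1 / 2) (f.toLp 2) < ⊤ := hT.trans_lt (by finiteness)
  have hD : coulomb (f.toLp 2 volume) = coulomb f := coulomb_congr_ae hf
  have hP : ∫⁻ x, ‖f.toLp 2 volume x‖ₑ ^ (8 / 3 : ℝ) = ∫⁻ x, ‖f x‖ₑ ^ (8 / 3 : ℝ) :=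
    lintegral_congr_ae (hf.mono fun x hx ↦ by simp only [hx])
  have hmem : f.toLp 2 volume ∈ sphere (eLpNorm f 2 volume ^ 2).toReal := by
    refine ⟨hT_top, ?_⟩
    rw [integral_norm_sq_eq_toReal (Lp.aestronglyMeasurable _), eLpNorm_congr_ae hf]
  refine (iInf₂_le _ hmem).trans ?_
  rw [energy_eq_coe hT_top.ne (hD ▸ coulomb_schwartz_ne_top f)
    (hP ▸ lintegral_eight_thirds_schwartz_ne_top f), hD, hP, EReal.coe_le_coe_iff,
    ← ENNReal.toReal_add hM hK]
  gcongr
  finiteness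

lemma minEnergy_rescaling_le (f : 𝓢(R3, ℂ)) {s l : ℝ} (hs : 0 < s) (hl : 0 < l) :
    minEnergy (8 / 3) α β (s ^ 3 * (eLpNorm f 2 volume ^ 2).toReal) ≤
      ((s ^ 3 * (1 / 2 * (eLpNorm f 2 volume ^ 2).toReal) +
        l * (s ^ 3 * (1 / 2 * (homSobolevNorm (1 / 2) f ^ 2).toReal +
          α * s ^ 3 * (coulomb f).toReal -
          β * s * (∫⁻ x, ‖f x‖ₑ ^ (8 / 3 : ℝ)).toReal)) : ℝ) : EReal) := by
  obtain ⟨g, hM, hK, hD, hP⟩ := exists_rescaling f hs hl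
  have h := minEnergy_schwartz_le (α := α) (β := β) g
  simp only [hM, hK, hD, hP, ENNReal.toReal_mul] at h
  rw [ENNReal.toReal_ofReal (by positivity), ENNReal.toReal_ofReal (by positivity),
    ENNReal.toReal_ofReal (by positivity), ENNReal.toReal_ofReal (by positivity)] at h
  exact h.trans_eq (by congr 1; ring)

lemma exists_minEnergy_eq_bot (hα : 0 < α) (hβ : 0 < β)
    (h : ENNReal.ofReal (criticalConstant α β) < bestConstant) :
    ∃ ρ : ℝ, 0 < ρ ∧ minEnergy (8 / 3) α β ρ = ⊥ := by
  obtain ⟨f, hf⟩ := exists_schwartz_of_lt_bestConstant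
    (ENNReal.ofReal_pos.2 (criticalConstant_pos hα hβ)) h
  have hP_top := lintegral_eight_thirds_schwartz_ne_top f
  have hmass : 0 < (eLpNorm f 2 volume ^ 2).toReal := by
    refine ENNReal.toReal_pos (fun hzero ↦ ?_)
      (ENNReal.pow_ne_top (f.memLp 2 volume).eLpNorm_ne_top)
    have hf₀ : f =ᵐ[volume] 0 :=
      (eLpNorm_eq_zero_iff f.continuous.aestronglyMeasurable two_ne_zero).1 (by simpa using hzero)
    have hP₀ : eLpNorm f (8 / 3) volume ^ 8 = 0 := by simp [eLpNorm_congr_ae hf₀]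
    simp [← eLpNorm_eight_thirds_pow_eight, hP₀] at hf
  have hreal := ENNReal.toReal_strict_mono (ENNReal.pow_ne_top hP_top) hf
  rw [← ENNReal.ofReal_pow (criticalConstant_pos hα hβ).le, criticalConstant_pow_eight hα.le hβ.le,
    ENNReal.toReal_pow, ENNReal.toReal_mul, ENNReal.toReal_mul, ENNReal.toReal_pow _ 2,
    ENNReal.toReal_ofReal (by positivity), div_mul_eq_mul_div, div_lt_iff₀ (by positivity)] at hreal
  obtain ⟨s, hs, hneg⟩ := exists_amplitude hα ENNReal.toReal_nonneg ENNReal.toReal_nonneg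
    ((mul_assoc _ _ _).trans_lt (hreal.trans_eq (mul_comm _ _)))
  exact ⟨_, mul_pos (pow_pos hs 3) hmass, eq_bot_of_forall_le_add_mul
    (mul_neg_of_pos_of_neg (pow_pos hs 3) hneg) fun l hl ↦ minEnergy_rescaling_le f hs hl⟩

end Energy

end SemiRelativistic

end

theorem theorem1p2 (α β : ℝ) (hα : 0 < α) (hβ : 0 < β) :
    (∃ ρ : ℝ, 0 < ρ ∧ SemiRelativistic.minEnergy (8 / 3) α β ρ = ⊥) ↔
      ENNReal.ofReal ((27 * α / β ^ 3) ^ (1 / 8 : ℝ))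
        < ENNReal.ofReal (Real.sqrt 2) * SemiRelativistic.bestConstant := by
  rw [← SemiRelativistic.ofReal_criticalConstant_lt]
  refine ⟨fun ⟨ρ, _, hρ⟩ ↦ ?_, SemiRelativistic.exists_minEnergy_eq_bot hα hβ⟩
  by_contra! hle
  have hnonneg : 0 ≤ SemiRelativistic.minEnergy (8 / 3) α β ρ :=
    le_iInf₂ fun u hu ↦ SemiRelativistic.energy_nonneg hα hβ hle hu.1
  simp [hρ] at hnonneg
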